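/- **Setting.** For a set $X$, $\mathcal D(X)$ is the set of rational probability distributions on $X$. A (finite) MDP $\mathcal M=(S,A,\delta)$ consists of finite sets $S$ (states) and $A$ (actions) and a partial function $\delta\colon S\times A\to\mathcal D(S)$; $A(s)$ is the set of actions $a$ for which $\delta(s,a)$ is defined, and $A(s)\neq\emptyset$ for all $s$. A run is an infinite sequence $\rho=s_0a_0s_1a_1\ldots$ with $a_i\in A(s_i)$ and $\delta(s_i,a_i)(s_{i+1})>0$ for all $i$; $\rho[n,\infty]=s_na_ns_{n+1}\ldots$; a history is a finite prefix $\rho[0,n]=s_0a_0\ldots a_{n-1}s_n$ of a run. A sub-MDP of $\mathcal M$ is given by $S'\subseteq S$ and sets $\emptyset\ne A'(s)\subseteq A(s)$, $s\in S'$, such that $\mathrm{Supp}(\delta(s,a))\subseteq S'$ for all $s\in S'$, $a\in A'(s)$, with the restriction of $\delta$; it is itself an MDP. It is an end-component (EC) of $\mathcal M$ if $S'\neq\emptyset$ and its underlying graph is strongly connected. A sub-EC of an EC $\mathcal C=(S_{\mathcal C},A_{\mathcal C},\delta_{\mathcal C})$ is an EC $(S'',A'',\delta'')$ of $\mathcal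 M$ with $S''\subseteq S_{\mathcal C}$ and $A''(s)\subseteq A_{\mathcal C}(s)$ for all $s\in S''$. A strategy in $\mathcal C$ maps each history $h$ of $\mathcal C$ with last state $s$ to a distribution $\sigma(h)\in\mathcal D(A)$ with support in $A_{\mathcal C}(s)$. $\mathbb P^\sigma_{\mathcal C,s}$ is the probability measure on $(SA)^\omega$ obtained by executing $\mathcal C$ from $s$ under $\sigma$. An event $E$ is sure from $s$ under $\sigma$ if $E$ contains every run $s_0a_0s_1\ldots$ of $\mathcal C$ with $s_0=s$ and $\sigma(s_0a_0\ldots s_n)(a_n)>0$ for all $n$. **Window objectives.** Let $\Omega\in\{\mathsf{mp},\mathsf{par}\}$, where for $\mathsf{mp}$ a weight function $w\colon A\to\mathbb Z$ is given and for $\mathsf{par}$ a priority function $p\colon S\to\mathbb N$. For an integer $\lambda>0$, a run $\rho=s_0a_0s_1\ldots$ is in $\mathsf{GW}_{\mathsf{mp}}(\lambda)$ iff $\frac1{l+1}\sum_{i=0}^{l}w(a_i)\ge 0$ for some $0\le l<\lambda$, and in $\mathsf{GW}_{\mathsf{par}}(\lambda)$ iff for some $0\le l<\lambda$ the priority $p(s_l)$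 is even and $p(s_l)<p(s_k)$ for all $k<l$. Further, $\rho\in\mathsf{DFW}_\Omega(\lambda)$ iff $\rho[j,\infty]\in\mathsf{GW}_\Omega(\lambda)$ for all $j\ge0$; $\rho\in\mathsf{FW}_\Omega(\lambda)$ iff $\rho[i,\infty]\in\mathsf{DFW}_\Omega(\lambda)$ for some $i\ge0$; and $\rho\in\mathsf{BW}_\Omega$ iff $\rho\in\mathsf{FW}_\Omega(\lambda)$ for some $\lambda>0$. An EC $\mathcal C$ is $\lambda$-safe if there is a strategy $\sigma$ in $\mathcal C$ such that $\mathsf{DFW}_\Omega(\lambda)$ is sure from every $s\in S_{\mathcal C}$ under $\sigma$. It is $\lambda$-good if it contains a $\lambda$-safe sub-EC, and $\mathsf{BW}$-good if it contains a sub-EC that is $\lambda$-safe for some $\lambda>0$. **Lemma (Zero-one law).** Let $\mathcal M$ be an MDP, $\Omega\in\{\mathsf{mp},\mathsf{par}\}$, and $\mathcal C=(S_{\mathcal C},A_{\mathcal C},\delta_{\mathcal C})$ an EC of $\mathcal M$. (a) For every $\lambda>0$, either (i) $\mathcal C$ is $\lambda$-good and there is a strategy $\sigma$ in $\mathcal C$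 with $\mathbb P^\sigma_{\mathcal C,s}[\mathsf{FW}_\Omega(\lambda)]=1$ for all $s\in S_{\mathcal C}$; or (ii) $\mathcal C$ is not $\lambda$-good and $\mathbb P^\sigma_{\mathcal C,s}[\mathsf{FW}_\Omega(\lambda)]=0$ for all $s\in S_{\mathcal C}$ and all strategies $\sigma$ in $\mathcal C$. (b) Either (i) $\mathcal C$ is $\mathsf{BW}$-good and there is a strategy $\sigma$ in $\mathcal C$ with $\mathbb P^\sigma_{\mathcal C,s}[\mathsf{BW}_\Omega]=1$ for all $s\in S_{\mathcal C}$; or (ii) $\mathcal C$ is not $\mathsf{BW}$-good and $\mathbb P^\sigma_{\mathcal C,s}[\mathsf{BW}_\Omega]=0$ for all $s\in S_{\mathcal C}$ and all strategies $\sigma$ in $\mathcal C$. -/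

import Mathlib

open MeasureTheory ProbabilityTheory
open scoped ENNReal NNReal

/-- `𝒟(α)`: the rational probability distributions on `α`. -/
def RatDist (α : Type*) : Type _ :=
  {p : PMF α // ∀ x, ∃ q : ℚ≥0, p x = ((q : ℝ≥0) : ℝ≥0∞)}

/-- A Markov decision process with state set `S` and action set `A`. The transition function `δ`
is partial: `δ s a = none` means that `a` is not available in `s`. -/
structure MDP (S A : Type*) where
  δ : S → A → Option (RatDist S)
  deadlockFree : ∀ s, ∃ a, (δ s a).isSome

/-- A play `s₀ a₀ s₁ a₁ …`, i.e. an element of `(S A)^ω`; `ρ n = (sₙ, aₙ)`. -/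
abbrev Play (S A : Type*) : Type _ := ℕ → S × A

/-- The finite word `s₀ a₀ … aₙ₋₁ sₙ` is represented by `([(s₀, a₀), …, (sₙ₋₁, aₙ₋₁)], sₙ)`. -/
abbrev FinPlay (S A : Type*) : Type _ := List (S × A) × S

namespace Play

variable {S A : Type*}

/-- The prefix `ρ[0, n] = s₀ a₀ … aₙ₋₁ sₙ`. -/
def pre (ρ : Play S A) (n : ℕ) : FinPlay S A := (List.ofFn fun i : Fin n => ρ i, (ρ n).1)

/-- The suffix `ρ[n, ∞] = sₙ aₙ sₙ₊₁ aₙ₊₁ …`. -/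
def suffix (ρ : Play S A) (n : ℕ) : Play S A := fun i => ρ (n + i)

end Play

namespace MDP

variable {S A : Type*}

/-- `A(s)`, the actions available in `s`. -/
def avail (M : MDP S A) (s : S) : Set A := {a | (M.δ s a).isSome}

/-- The distribution of the successor of `s` under `a`. It is `δ(s, a)` if `a ∈ A(s)`; otherwise
the (irrelevant) value is the Dirac distribution in `s`. -/
noncomputable def next (M : MDP S A) (s : S) (a : A) : PMF S :=
  match M.δ s a with
  | some d => d.1
  | none => PMF.pure s

/-- A sub-MDP `(S', A', δ')` of `M`. As `δ'` is the restriction of `δ`, it is determined by the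
states and by the actions `A'(s)` enabled in each of these states. (The value of `act` outside
`states` plays no role.) -/
structure SubMDP (M : MDP S A) where
  states : Set S
  act : S → Set A
  act_nonempty : ∀ s ∈ states, (act s).Nonempty
  act_subset : ∀ s ∈ states, act s ⊆ M.avail s
  closed : ∀ s ∈ states, ∀ a ∈ act s, (M.next s a).support ⊆ states

namespace SubMDP

variable {M : MDP S A}

/-- `(s, a, t) ∈ δ'`: the action `a` is enabled in the state `s` of the sub-MDP and may
lead to `t`. -/
def Trans (C : SubMDP M) (s : S) (a : A) (t : S) : Prop :=
  s ∈ C.states ∧ a ∈ C.act s ∧ t ∈ (M.next s a).support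

/-- The runs of the MDP `C`. -/
def runs (C : SubMDP M) : Set (Play S A) :=
  {ρ | ∀ i, C.Trans (ρ i).1 (ρ i).2 (ρ (i + 1)).1}

/-- The histories of `C`: the finite prefixes of its runs. -/
def hists (C : SubMDP M) : Set (FinPlay S A) :=
  {h | ∃ ρ ∈ C.runs, ∃ n, h = ρ.pre n}

/-- `C` is an end-component of `M`: its underlying graph is (non-empty and) strongly connected. -/
def IsEC (C : SubMDP M) : Prop :=
  C.states.Nonempty ∧
    ∀ s ∈ C.states, ∀ t ∈ C.states, Relation.ReflTransGen (fun x y => ∃ a, C.Trans x a y) s t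

/-- `C'` is a sub-EC of `C`. -/
def IsSubEC (C' C : SubMDP M) : Prop :=
  C'.IsEC ∧ C'.states ⊆ C.states ∧ ∀ s ∈ C'.states, C'.act s ⊆ C.act s

/-- A strategy in the MDP `C`: it assigns to every history a rational distribution over the
actions enabled in the last state. (Its values on words that are not histories of `C` are
irrelevant.) -/
structure Strategy (C : SubMDP M) where
  toFun : FinPlay S A → RatDist A
  supp : ∀ h ∈ C.hists, (toFun h).1.support ⊆ C.act h.2

namespace Strategy

variable {C : SubMDP M}

/-- The runs of the Markov chain induced by `C`, `σ` and the initial state `s`. -/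
def runsFrom (σ : C.Strategy) (s : S) : Set (Play S A) :=
  {ρ | ρ ∈ C.runs ∧ (ρ 0).1 = s ∧ ∀ n, (ρ n).2 ∈ (σ.toFun (ρ.pre n)).1.support}

/-- After the word `h`, the strategy chooses an action: the law of the pair
(last state of `h`, chosen action). -/
noncomputable def choose (σ : C.Strategy) (h : FinPlay S A) : PMF (S × A) :=
  (σ.toFun h).1.map fun a => (h.2, a)

/-- The conditional law of `(sₙ₊₁, aₙ₊₁)` given `s₀ a₀ … sₙ aₙ`: the successor `sₙ₊₁` has law
`δ(sₙ, aₙ)`, and then `aₙ₊₁` has law `σ(s₀ a₀ … sₙ aₙ sₙ₊₁)`. -/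
noncomputable def stepPMF (σ : C.Strategy) (n : ℕ) (x : (i : Finset.Iic n) → S × A) :
    PMF (S × A) :=
  let last : S × A := x ⟨n, Finset.mem_Iic.2 le_rfl⟩
  (M.next last.1 last.2).bind fun t =>
    σ.choose
      (List.ofFn fun i : Fin (n + 1) => x ⟨i, Finset.mem_Iic.2 (Nat.le_of_lt_succ i.2)⟩, t)

variable [Finite S] [Finite A]
  [MeasurableSpace S] [DiscreteMeasurableSpace S] [MeasurableSpace A] [DiscreteMeasurableSpace A]

/-- `stepPMF` as a Markov kernel. -/
noncomputable def stepKernel (σ : C.Strategy) (n : ℕ) :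
    Kernel ((i : Finset.Iic n) → S × A) (S × A) :=
  Kernel.ofFunOfCountable fun x => (σ.stepPMF n x).toMeasure

instance (σ : C.Strategy) (n : ℕ) : IsMarkovKernel (σ.stepKernel n) :=
  ⟨fun x => inferInstanceAs (IsProbabilityMeasure (σ.stepPMF n x).toMeasure)⟩

/-- `ℙ_{C,s}^σ`: the probability measure on `(S A)^ω` (with the product `σ`-algebra, which is
generated by the cylinders) obtained by executing `C` from `s` with the strategy `σ`. -/
noncomputable def prob (σ : C.Strategy) (s : S) : Measure (Play S A) :=
  Kernel.trajMeasure (X := fun _ => S × A) (σ.choose ([], s)).toMeasure σ.stepKernel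

/-- The event `E` is sure from `s` under `σ`: all runs of the induced Markov chain are in `E`. -/
def Sure (σ : C.Strategy) (s : S) (E : Set (Play S A)) : Prop :=
  σ.runsFrom s ⊆ E

end Strategy

end SubMDP

end MDP

/-- The two variants of window objectives, together with the data which they are based on: a
weight function on the actions for mean-payoff, a priority function on the states for parity. -/
inductive WindowKind (S A : Type*)
  | mp (w : A → ℤ)
  | par (p : S → ℕ)

/-- The mean-payoff `(1 / n) ∑_{i < n} w(aᵢ)` of the prefix `ρ[0, n]`, for `n > 0`. -/
def meanPayoff {S A : Type*} (w : A → ℤ) (ρ : Play S A) (n : ℕ) : ℚ :=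
  (∑ i ∈ Finset.range n, (w (ρ i).2 : ℚ)) / n

namespace MDP.SubMDP

variable {S A : Type*} {M : MDP S A}

/-- Good window objective of size `l` (in the MDP `C`): the window which opens at the first
position is closed within `l` steps. -/
def GW (C : SubMDP M) (Ω : WindowKind S A) (l : ℕ) : Set (Play S A) :=
  match Ω with
  | .mp w => {ρ | ρ ∈ C.runs ∧ ∃ j < l, 0 ≤ meanPayoff w ρ (j + 1)}
  | .par p => {ρ | ρ ∈ C.runs ∧ ∃ j < l, p (ρ j).1 % 2 = 0 ∧ ∀ k < j, p (ρ j).1 < p (ρ k).1}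

/-- Direct fixed window objective. -/
def DFW (C : SubMDP M) (Ω : WindowKind S A) (l : ℕ) : Set (Play S A) :=
  {ρ | ρ ∈ C.runs ∧ ∀ j, ρ.suffix j ∈ C.GW Ω l}

/-- Fixed window objective. -/
def FW (C : SubMDP M) (Ω : WindowKind S A) (l : ℕ) : Set (Play S A) :=
  {ρ | ρ ∈ C.runs ∧ ∃ i, ρ.suffix i ∈ C.DFW Ω l}

/-- Bounded window objective. -/
def BW (C : SubMDP M) (Ω : WindowKind S A) : Set (Play S A) :=
  {ρ | ρ ∈ C.runs ∧ ∃ l > 0, ρ ∈ C.FW Ω l}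

/-- `C` is `l`-safe: some strategy in `C` surely satisfies `DFW(l)` from all states of `C`. -/
def IsSafe (C : SubMDP M) (Ω : WindowKind S A) (l : ℕ) : Prop :=
  ∃ σ : C.Strategy, ∀ s ∈ C.states, σ.Sure s (C.DFW Ω l)

/-- `C` is `l`-good: it contains an `l`-safe sub-EC. -/
def IsGood (C : SubMDP M) (Ω : WindowKind S A) (l : ℕ) : Prop :=
  ∃ C' : SubMDP M, C'.IsSubEC C ∧ C'.IsSafe Ω l

/-- `C` is `BW`-good: it contains a sub-EC which is `l`-safe for some `l > 0`. -/
def IsBWGood (C : SubMDP M) (Ω : WindowKind S A) : Prop :=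
  ∃ C' : SubMDP M, C'.IsSubEC C ∧ ∃ l > 0, C'.IsSafe Ω l

end MDP.SubMDP

/-! Under every strategy, the play is almost surely fair: by Lévy's conditional Borel–Cantelli
lemma, a successor which is possible after a recurring finite word follows this word infinitely
often.

If `C` has a safe sub-EC `C'`, choose in every state outside `C'` an action which may lead to a
state closer to `C'`. A fair run visits `C'`: a recurring state of minimal distance could not lie
outside. From the first visit on, play the safe strategy of `C'`.

Conversely, let a fair run satisfy `FW(l)`. The states and actions recurring in it form a sub-EC. In
this sub-EC, choose the actions such that the last `l + 1` letters always form a word which recurs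
in the run; fairness allows this. Every window of the resulting plays is then a late window of the
run, and hence is closed in time.
-/

section Trajectory

open Filter Preorder

variable {X : ℕ → Type*} [∀ n, MeasurableSpace (X n)]
  {μ₀ : Measure (X 0)}
  {κ : (n : ℕ) → Kernel ((i : Finset.Iic n) → X i) (X (n + 1))} [∀ n, IsMarkovKernel (κ n)]

lemma map_eval_zero_trajMeasure : (Kernel.trajMeasure μ₀ κ).map (fun ω => ω 0) = μ₀ := by
  have h0 : (fun ω : (n : ℕ) → X n => ω 0) =
      (fun x : (i : Finset.Iic 0) → X i => x ⟨0, Finset.mem_Iic.2 le_rfl⟩) ∘ frestrictLe 0 := rfl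
  rw [h0, ← Measure.map_map (by fun_prop) (by fun_prop), Kernel.trajMeasure,
    Measure.map_comp _ _ (by fun_prop), Kernel.traj_map_frestrictLe, Kernel.partialTraj_self,
    Measure.id_comp]
  exact (Measure.map_map (by fun_prop) (by fun_prop)).trans Measure.map_id

lemma measurableSet_piLE_succ {n : ℕ} {T : Set (((i : Finset.Iic n) → X i) × X (n + 1))}
    (hT : MeasurableSet T) :
    MeasurableSet[Filtration.piLE (X := X) (n + 1)] {ω | (frestrictLe n ω, ω (n + 1)) ∈ T} := by
  rw [Filtration.piLE_eq_comap_frestrictLe]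
  refine ⟨{x | (frestrictLe₂ n.le_succ x, x ⟨n + 1, Finset.mem_Iic.2 le_rfl⟩) ∈ T}, ?_, rfl⟩
  exact (Measurable.prodMk (by fun_prop) (by fun_prop)) hT

variable [IsProbabilityMeasure μ₀]

lemma condExp_trajMeasure_indicator {n : ℕ} [StandardBorelSpace (X (n + 1))]
    [Nonempty (X (n + 1))] {T : Set (((i : Finset.Iic n) → X i) × X (n + 1))}
    (hT : MeasurableSet T) :
    (Kernel.trajMeasure μ₀ κ)[{ω | (frestrictLe n ω, ω (n + 1)) ∈ T}.indicator
        (1 : ((n : ℕ) → X n) → ℝ) | Filtration.piLE (X := X) n] =ᵐ[Kernel.trajMeasure μ₀ κ]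
      fun ω => (κ n (frestrictLe n ω)).real (Prod.mk (frestrictLe n ω) ⁻¹' T) := by
  have hZ : Measurable fun ω : (n : ℕ) → X n => (frestrictLe n ω, ω (n + 1)) := by fun_prop
  have h1 := condExp_prod_ae_eq_integral_condDistrib (μ := Kernel.trajMeasure μ₀ κ)
    (X := frestrictLe n) (Y := fun ω : (n : ℕ) → X n => ω (n + 1))
    (f := T.indicator fun _ => (1 : ℝ))
    (measurable_frestrictLe n) (measurable_pi_apply _).aemeasurable
    (stronglyMeasurable_const.indicator hT) ((integrable_const (1 : ℝ)).indicator (hZ hT))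
  have h2 := ae_of_ae_map (measurable_frestrictLe n).aemeasurable
    (Kernel.condDistrib_trajMeasure (μ₀ := μ₀) (κ := κ) (a := n))
  rw [Filtration.piLE_eq_comap_frestrictLe]
  refine h1.trans ?_
  filter_upwards [h2] with ω hω
  rw [hω]
  exact integral_indicator_one (measurable_prodMk_left hT)

lemma ae_frequently_trajMeasure [∀ n, StandardBorelSpace (X n)] [∀ n, Nonempty (X n)]
    {E : ∀ n : ℕ, Set ((i : Finset.Iic n) → X i)}
    {T : ∀ n, Set (((i : Finset.Iic n) → X i) × X (n + 1))} (hT : ∀ n, MeasurableSet (T n))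
    {p : ℝ} (hp : 0 < p) (h : ∀ n, ∀ x ∈ E n, p ≤ (κ n x).real (Prod.mk x ⁻¹' T n)) :
    ∀ᵐ ω ∂Kernel.trajMeasure μ₀ κ, (∃ᶠ n in atTop, frestrictLe n ω ∈ E n) →
      ∃ᶠ n in atTop, (frestrictLe n ω, ω (n + 1)) ∈ T n := by
  let s : ℕ → Set ((n : ℕ) → X n) :=
    fun n => n.casesOn ∅ fun n => {ω | (frestrictLe n ω, ω (n + 1)) ∈ T n}
  have hs : ∀ n, MeasurableSet[Filtration.piLE (X := X) n] (s n) := by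
    rintro (_ | n)
    exacts [@MeasurableSet.empty _ (_), measurableSet_piLE_succ (hT n)]
  filter_upwards [ae_mem_limsup_atTop_iff (Kernel.trajMeasure μ₀ κ) hs,
    ae_all_iff.2 fun n => condExp_trajMeasure_indicator (μ₀ := μ₀) (κ := κ) (hT n)]
    with ω hω hcond hE
  have hlimsup : ω ∈ limsup s atTop := by
    rw [hω, tendsto_congr fun n => Finset.sum_congr rfl fun k _ => hcond k,
      ← not_summable_iff_tendsto_nat_atTop_of_nonneg fun _ => measureReal_nonneg]
    intro hsum
    obtain ⟨n, hn, hlt⟩ :=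
      (hE.and_eventually (hsum.tendsto_atTop_zero.eventually (gt_mem_nhds hp))).exists
    exact (h n _ hn).not_gt hlt
  rw [← limsup_nat_add s 1, mem_limsup_iff_frequently_mem] at hlimsup
  exact hlimsup

end Trajectory

lemma exists_rank_of_reflTransGen {α : Type*} (r : α → α → Prop) (T : Set α) :
    ∃ d : α → ℕ, ∀ x ∉ T, (∃ y ∈ T, Relation.ReflTransGen r x y) → ∃ z, r x z ∧ d z < d x := by
  let reach : ℕ → Set α := fun n => (fun U => {x | ∃ y ∈ U, r x y})^[n] T
  have hsucc : ∀ n x, x ∈ reach (n + 1) ↔ ∃ y ∈ reach n, r x y := fun n x => by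
    simp only [reach, Function.iterate_succ_apply', Set.mem_ofPred_eq]
  have hreach : ∀ y ∈ T, ∀ x, Relation.ReflTransGen r x y → {n | x ∈ reach n}.Nonempty := by
    intro y hy x hxy
    induction hxy using Relation.ReflTransGen.head_induction_on with
    | refl => exact ⟨0, hy⟩
    | head hxz _ ih =>
      obtain ⟨n, hn⟩ := ih
      exact ⟨n + 1, (hsucc n _).2 ⟨_, hn, hxz⟩⟩
  refine ⟨fun x => sInf {n | x ∈ reach n}, fun x hx ⟨y, hy, hxy⟩ => ?_⟩
  have hmem : x ∈ reach (sInf {n | x ∈ reach n}) := Nat.sInf_mem (hreach y hy x hxy)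
  rcases hd : sInf {n | x ∈ reach n} with _ | k
  · rw [hd] at hmem
    exact absurd hmem hx
  · rw [hd] at hmem
    obtain ⟨z, hz, hxz⟩ := (hsucc k x).1 hmem
    exact ⟨z, hxz, (Nat.lt_succ_of_le (Nat.sInf_le hz)).trans_eq hd.symm⟩

lemma frequently_atTop_add {p : ℕ → Prop} (k : ℕ) :
    (∃ᶠ n in Filter.atTop, p (n + k)) ↔ ∃ᶠ n in Filter.atTop, p n := by
  rw [← Filter.frequently_map (P := p) (m := (· + k)), Filter.map_add_atTop_eq_nat]

namespace Play

open Filter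

variable {S A : Type*} {ρ ρ' : Play S A}

/-- The prefix `s₀ a₀ … sₙ₋₁ aₙ₋₁` of a play, without the state `sₙ` that ends `ρ[0, n]`. -/
def word (ρ : Play S A) (n : ℕ) : List (S × A) := List.ofFn fun i : Fin n => ρ i

lemma word_succ (ρ : Play S A) (n : ℕ) : ρ.word (n + 1) = ρ.word n ++ [ρ n] := by
  simp only [word, List.ofFn_succ_last, Fin.val_castSucc, Fin.val_last]

lemma word_add (ρ : Play S A) (m n : ℕ) : ρ.word (m + n) = ρ.word m ++ (ρ.suffix m).word n := by
  simp only [word, List.ofFn_add, Fin.val_castLE, Fin.val_natAdd, suffix]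

lemma length_word (ρ : Play S A) (n : ℕ) : (ρ.word n).length = n := List.length_ofFn

lemma pre_congr {n : ℕ} (h : ∀ i < n, ρ i = ρ' i) (hn : (ρ n).1 = (ρ' n).1) :
    ρ.pre n = ρ'.pre n :=
  Prod.ext (congrArg List.ofFn (funext fun i : Fin n => h i i.2)) hn

lemma suffix_suffix (ρ : Play S A) (m n : ℕ) : (ρ.suffix m).suffix n = ρ.suffix (m + n) := by
  funext i
  simp only [suffix, add_assoc]

/-- The finite word `u` occurs infinitely often in the play `ρ`. -/
def Recurs (ρ : Play S A) (u : List (S × A)) : Prop := ∃ᶠ n in atTop, u <:+ ρ.word n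

lemma Recurs.of_suffix {u v : List (S × A)} (hv : ρ.Recurs v) (huv : u <:+ v) : ρ.Recurs u :=
  hv.mono fun _ => huv.trans

lemma recurs_singleton {x : S × A} : ρ.Recurs [x] ↔ ∃ᶠ n in atTop, ρ n = x := by
  rw [Recurs, ← frequently_atTop_add 1]
  simp only [word_succ, List.singleton_suffix_append_singleton_iff, eq_comm]

lemma Recurs.frequently_suffix_eq {n : ℕ} (h : ρ.Recurs (ρ'.word n)) :
    ∃ᶠ k in atTop, ∀ i < n, ρ.suffix k i = ρ' i := by
  refine ((frequently_atTop_add n).2 h).mono fun k hk i hi => ?_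
  rw [word_add] at hk
  have hsuf : ρ'.word n <:+ (ρ.suffix k).word n :=
    List.suffix_of_suffix_length_le hk (List.suffix_append _ _) (by simp only [length_word, le_rfl])
  have heq := hsuf.eq_of_length (by simp only [length_word])
  exact (congrFun (List.ofFn_injective heq) ⟨i, hi⟩).symm

lemma eventually_recurs [Finite S] [Finite A] (ρ : Play S A) : ∀ᶠ n in atTop, ρ.Recurs [ρ n] := by
  have h : ∀ᶠ n in atTop, ∀ x, ρ n = x → ρ.Recurs [x] := by
    refine eventually_all.2 fun x => ?_
    by_cases hx : ρ.Recurs [x]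
    · exact .of_forall fun _ _ => hx
    · exact (not_frequently.1 (recurs_singleton.not.1 hx)).mono fun _ hn h => absurd h hn
  exact h.mono fun n hn => hn _ rfl

end Play

namespace MDP

variable {S A : Type*} {M : MDP S A}

namespace SubMDP

variable {C : SubMDP M} {s : S} {ρ : Play S A}

lemma Trans.mem_states {a : A} {t : S} (h : C.Trans s a t) : t ∈ C.states :=
  C.closed s h.1 a h.2.1 h.2.2

lemma exists_run (hs : s ∈ C.states) : ∃ ρ ∈ C.runs, (ρ 0).1 = s := by
  have hstep : ∀ x : C.states, ∃ a ∈ C.act x, ∃ t : C.states, t.1 ∈ (M.next x a).support := by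
    rintro ⟨x, hx⟩
    obtain ⟨a, ha⟩ := C.act_nonempty x hx
    obtain ⟨t, ht⟩ := (M.next x a).support_nonempty
    exact ⟨a, ha, ⟨t, C.closed x hx a ha ht⟩, ht⟩
  choose α hα β hβ using hstep
  refine ⟨fun n => ((β^[n] ⟨s, hs⟩).1, α (β^[n] ⟨s, hs⟩)), fun i => ⟨Subtype.prop _, hα _, ?_⟩, rfl⟩
  simp only [Function.iterate_succ_apply']
  exact hβ _

lemma suffix_mem_runs (h : ρ ∈ C.runs) (n : ℕ) : ρ.suffix n ∈ C.runs :=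
  fun i => h (n + i)

lemma pre_mem_hists {n : ℕ} (h : ∀ i < n, C.Trans (ρ i).1 (ρ i).2 (ρ (i + 1)).1)
    (hn : (ρ n).1 ∈ C.states) : ρ.pre n ∈ C.hists := by
  obtain ⟨r, hr, hr0⟩ := exists_run hn
  refine ⟨fun i => if i < n then ρ i else r (i - n), fun i => ?_, n, ?_⟩
  · rcases lt_trichotomy (i + 1) n with hi | rfl | hi
    · have hi' : i < n := by omega
      simpa only [hi, hi', if_true] using h i hi'
    · simpa [hr0] using h i (Nat.lt_succ_self i)
    · have hi₁ : ¬ i < n := by omega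
      have hi₂ : ¬ i + 1 < n := by omega
      simpa only [hi₁, hi₂, if_false, Nat.sub_add_comm (not_lt.1 hi₁)] using hr (i - n)
  · exact Play.pre_congr (fun i hi => by simp only [hi, if_true]) (by simp [hr0])

lemma mem_states_of_mem_hists {h : FinPlay S A} (hh : h ∈ C.hists) : h.2 ∈ C.states := by
  obtain ⟨ρ, hρ, n, rfl⟩ := hh
  exact (hρ n).1

namespace Strategy

variable {σ : C.Strategy}

lemma mem_runsFrom_of_forall (hs : s ∈ C.states) (h0 : (ρ 0).1 = s)
    (hnext : ∀ n, (ρ (n + 1)).1 ∈ (M.next (ρ n).1 (ρ n).2).support)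
    (hact : ∀ n, ρ.pre n ∈ C.hists → (ρ n).2 ∈ (σ.toFun (ρ.pre n)).1.support) :
    ρ ∈ σ.runsFrom s := by
  have hist : ∀ n, (ρ n).1 ∈ C.states ∧ ∀ i < n, C.Trans (ρ i).1 (ρ i).2 (ρ (i + 1)).1 := by
    intro n
    induction n with
    | zero => exact ⟨h0 ▸ hs, fun i hi => absurd hi i.not_lt_zero⟩
    | succ n ih =>
      have hpre := pre_mem_hists ih.2 ih.1
      have htrans : C.Trans (ρ n).1 (ρ n).2 (ρ (n + 1)).1 :=
        ⟨ih.1, σ.supp _ hpre (hact n hpre), hnext n⟩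
      exact ⟨htrans.mem_states, fun i hi =>
        (Nat.lt_succ_iff_lt_or_eq.1 hi).elim (ih.2 i) fun hin => hin ▸ htrans⟩
  exact ⟨fun i => (hist (i + 1)).2 i i.lt_succ_self, h0,
    fun n => hact n (pre_mem_hists (hist n).2 (hist n).1)⟩

lemma mem_support_choose {h : FinPlay S A} {y : S × A} :
    y ∈ (σ.choose h).support ↔ y.1 = h.2 ∧ y.2 ∈ (σ.toFun h).1.support := by
  rw [choose, PMF.mem_support_map_iff]
  exact ⟨fun ⟨a, ha, hy⟩ => hy ▸ ⟨rfl, ha⟩, fun ⟨h1, h2⟩ => ⟨y.2, h2, Prod.ext h1.symm rfl⟩⟩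

lemma mem_support_stepPMF {n : ℕ} {y : S × A} :
    y ∈ (σ.stepPMF n fun i => ρ i).support ↔ y.1 ∈ (M.next (ρ n).1 (ρ n).2).support ∧
      y.2 ∈ (σ.toFun (ρ.word (n + 1), y.1)).1.support := by
  rw [stepPMF, PMF.mem_support_bind_iff]
  simp only [mem_support_choose]
  exact ⟨fun ⟨t, ht, hy, ha⟩ => hy ▸ ⟨ht, ha⟩, fun ⟨ht, ha⟩ => ⟨y.1, ht, rfl, ha⟩⟩

end Strategy

end SubMDP

/-- A play is fair if, whenever a word ending with the choice of the action `a` in the state `s`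
recurs, each possible successor of `s` under `a` follows this word infinitely often. -/
def IsFair (M : MDP S A) (ρ : Play S A) : Prop :=
  ∀ u s a, ∀ t ∈ (M.next s a).support, ρ.Recurs (u ++ [(s, a)]) →
    ∃ᶠ n in Filter.atTop, u ++ [(s, a)] <:+ ρ.word n ∧ (ρ n).1 = t

lemma IsFair.exists_recurs [Finite A] {ρ : Play S A} (h : M.IsFair ρ) {u : List (S × A)} {s : S}
    {a : A} (hu : ρ.Recurs (u ++ [(s, a)])) {t : S} (ht : t ∈ (M.next s a).support) :
    ∃ b, ρ.Recurs (u ++ [(s, a), (t, b)]) := by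
  obtain ⟨b, hb⟩ : ∃ b, ∃ᶠ n in Filter.atTop, u ++ [(s, a)] <:+ ρ.word n ∧ ρ n = (t, b) :=
    Filter.frequently_exists.1 <|
      (h u s a t ht hu).mono fun n hn => ⟨(ρ n).2, hn.1, Prod.ext hn.2 rfl⟩
  refine ⟨b, (frequently_atTop_add 1).1 (hb.mono fun n hn => ?_)⟩
  rw [Play.word_succ, hn.2, List.append_cons u]
  exact List.suffix_append_self_iff.2 hn.1

lemma IsFair.exists_forall_le [Finite S] [Finite A] {ρ : Play S A} (h : M.IsFair ρ) (d : S → ℕ) :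
    ∃ n, ∀ t ∈ (M.next (ρ n).1 (ρ n).2).support, d (ρ n).1 ≤ d t := by
  obtain ⟨x, hx, hmin⟩ := Set.exists_min_image {x | ρ.Recurs [x]} (fun x => d x.1)
    (Set.toFinite _) (ρ.eventually_recurs.exists.imp' ρ fun _ => id)
  obtain ⟨n, rfl⟩ := (Play.recurs_singleton.1 hx).exists
  refine ⟨n, fun t ht => ?_⟩
  obtain ⟨b, hb⟩ := h.exists_recurs (u := []) hx ht
  exact hmin (t, b) (hb.of_suffix (List.suffix_cons _ _))

end MDP

namespace MDP.SubMDP.Strategy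

open Filter

variable {S A : Type*} {M : MDP S A} {C : SubMDP M} [Finite S] [Finite A]
  [MeasurableSpace S] [DiscreteMeasurableSpace S] [MeasurableSpace A] [DiscreteMeasurableSpace A]
  (σ : C.Strategy) (s : S)

instance : IsProbabilityMeasure (σ.prob s) :=
  inferInstanceAs (IsProbabilityMeasure (Kernel.trajMeasure (X := fun _ => S × A) _ _))

lemma ae_init_mem_support : ∀ᵐ ρ ∂σ.prob s, ρ 0 ∈ (σ.choose ([], s)).support := by
  refine ae_of_ae_map (f := fun ρ : Play S A => ρ 0) (measurable_pi_apply 0).aemeasurable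
    (p := fun y => y ∈ (σ.choose ([], s)).support) ?_
  rw [prob, map_eval_zero_trajMeasure]
  exact (mem_ae_iff_prob_eq_one .of_discrete).2
    ((PMF.toMeasure_apply_eq_one_iff _ .of_discrete).2 subset_rfl)

lemma ae_succ_mem_support (n : ℕ) :
    ∀ᵐ ρ ∂σ.prob s, ρ (n + 1) ∈ (σ.stepPMF n fun i => ρ i).support := by
  refine ae_of_ae_map (f := fun ρ : Play S A => (Preorder.frestrictLe n ρ, ρ (n + 1)))
    (by fun_prop) (p := fun y => y.2 ∈ (σ.stepPMF n y.1).support) ?_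
  rw [prob, ← Kernel.map_frestrictLe_trajMeasure_compProd_eq_map_trajMeasure,
    Measure.ae_compProd_iff .of_discrete]
  exact ae_of_all _ fun x => (mem_ae_iff_prob_eq_one .of_discrete).2
    ((PMF.toMeasure_apply_eq_one_iff _ .of_discrete).2 subset_rfl)

lemma ae_mem_runsFrom {s : S} (hs : s ∈ C.states) : ∀ᵐ ρ ∂σ.prob s, ρ ∈ σ.runsFrom s := by
  filter_upwards [σ.ae_init_mem_support s, ae_all_iff.2 (σ.ae_succ_mem_support s)] with ρ h0 hsucc
  obtain ⟨hs0, ha0⟩ := mem_support_choose.1 h0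
  refine mem_runsFrom_of_forall hs hs0 (fun n => (mem_support_stepPMF.1 (hsucc n)).1) ?_
  rintro (_ | n) -
  · have hpre : ρ.pre 0 = ([], s) := Prod.ext (List.ofFn_zero (f := fun i => ρ i)) hs0
    rwa [← hpre] at ha0
  · exact (mem_support_stepPMF.1 (hsucc n)).2

lemma next_le_stepKernel (n : ℕ) (x : (i : Finset.Iic n) → S × A) (t : S) :
    (M.next (x ⟨n, Finset.mem_Iic.2 le_rfl⟩).1 (x ⟨n, Finset.mem_Iic.2 le_rfl⟩).2 t).toReal ≤
      (σ.stepKernel n x).real {y | y.1 = t} := by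
  refine ENNReal.toReal_mono (measure_ne_top _ _) ?_
  change _ ≤ (σ.stepPMF n x).toMeasure {y | y.1 = t}
  rw [stepPMF, PMF.toMeasure_bind_apply _ _ _ .of_discrete]
  refine le_of_eq_of_le ?_ (ENNReal.le_tsum t)
  have hchoose : ∀ w, (σ.choose (w, t)).toMeasure {y | y.1 = t} = 1 := fun w =>
    (PMF.toMeasure_apply_eq_one_iff _ .of_discrete).2 fun y hy => (mem_support_choose.1 hy).1
  rw [hchoose, mul_one]

lemma ae_frequently_state_eq (u : List (S × A)) (q : S) (a : A) {t : S}
    (ht : t ∈ (M.next q a).support) : ∀ᵐ ρ ∂σ.prob s, ρ.Recurs (u ++ [(q, a)]) →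
      ∃ᶠ n in atTop, u ++ [(q, a)] <:+ ρ.word n ∧ (ρ n).1 = t := by
  have : Nonempty (S × A) := ⟨(q, a)⟩
  let E : ∀ n : ℕ, Set ((i : Finset.Iic n) → S × A) := fun n => {x | u ++ [(q, a)] <:+
    List.ofFn fun i : Fin (n + 1) => x ⟨i, Finset.mem_Iic.2 (Nat.le_of_lt_succ i.2)⟩}
  have hlast : ∀ n, ∀ x ∈ E n, x ⟨n, Finset.mem_Iic.2 le_rfl⟩ = (q, a) := fun n x hx => by
    have h := (List.suffix_append u [(q, a)]).trans hx
    rw [List.ofFn_succ_last] at h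
    exact (List.singleton_suffix_append_singleton_iff.1 h).symm
  have hstep : ∀ n, ∀ x ∈ E n, (M.next q a t).toReal ≤
      (σ.stepKernel n x).real (Prod.mk x ⁻¹' E n ×ˢ {y | y.1 = t}) := fun n x hx => by
    have h := σ.next_le_stepKernel n x t
    rwa [hlast n x hx, ← Set.mk_preimage_prod_right (t := {y : S × A | y.1 = t}) hx] at h
  have hfair := ae_frequently_trajMeasure (X := fun _ => S × A)
    (μ₀ := (σ.choose ([], s)).toMeasure) (T := fun n => E n ×ˢ {y | y.1 = t})
    (fun _ => .of_discrete) (ENNReal.toReal_pos ht (PMF.apply_ne_top _ _)) hstep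
  filter_upwards [hfair] with ρ h hu
  rw [Play.Recurs, ← frequently_atTop_add 1] at hu
  rw [← frequently_atTop_add 1]
  exact h hu

lemma ae_isFair : ∀ᵐ ρ ∂σ.prob s, M.IsFair ρ := by
  simp only [IsFair, ae_all_iff]
  exact fun u q a t ht => σ.ae_frequently_state_eq s u q a ht

end MDP.SubMDP.Strategy

/-- The window which opens at the first position of `ρ` is closed within `l` steps. -/
def WindowKind.Closes {S A : Type*} (Ω : WindowKind S A) (l : ℕ) (ρ : Play S A) : Prop :=
  match Ω with
  | .mp w => ∃ j < l, 0 ≤ meanPayoff w ρ (j + 1)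
  | .par p => ∃ j < l, p (ρ j).1 % 2 = 0 ∧ ∀ k < j, p (ρ j).1 < p (ρ k).1

lemma WindowKind.Closes.congr {S A : Type*} {Ω : WindowKind S A} {l : ℕ} {ρ ρ' : Play S A}
    (h : Ω.Closes l ρ) (he : ∀ i < l, ρ i = ρ' i) : Ω.Closes l ρ' := by
  cases Ω with
  | mp w =>
    obtain ⟨j, hj, hmean⟩ := h
    have hsum : meanPayoff w ρ (j + 1) = meanPayoff w ρ' (j + 1) := by
      unfold meanPayoff
      exact congrArg (· / _) <| Finset.sum_congr rfl fun i hi => by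
        rw [he i ((Finset.mem_range_succ_iff.1 hi).trans_lt hj)]
    exact ⟨j, hj, hsum ▸ hmean⟩
  | par p =>
    obtain ⟨j, hj, heven, hlt⟩ := h
    exact ⟨j, hj, he j hj ▸ heven, fun k hk => he j hj ▸ he k (hk.trans hj) ▸ hlt k hk⟩

/-- The Dirac distribution in `a`. -/
noncomputable def RatDist.pure {α : Type*} (a : α) : RatDist α :=
  ⟨PMF.pure a, fun x => by
    classical
    by_cases h : x = a
    · exact ⟨1, by simp [h]⟩
    · exact ⟨0, by simp [PMF.pure_apply, h]⟩⟩

lemma RatDist.mem_support_pure {α : Type*} {a x : α} : x ∈ (RatDist.pure a).1.support ↔ x = a :=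
  PMF.mem_support_pure_iff a x

namespace MDP.SubMDP

variable {S A : Type*} {M : MDP S A} {C : SubMDP M} {Ω : WindowKind S A} {l : ℕ} {ρ : Play S A}

lemma mem_GW : ρ ∈ C.GW Ω l ↔ ρ ∈ C.runs ∧ Ω.Closes l ρ := by
  cases Ω <;> rfl

lemma mem_DFW : ρ ∈ C.DFW Ω l ↔ ρ ∈ C.runs ∧ ∀ j, Ω.Closes l (ρ.suffix j) := by
  simp only [DFW, Set.mem_ofPred_eq, mem_GW]
  exact and_congr_right fun h => forall_congr' fun j => and_iff_right (suffix_mem_runs h j)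

lemma mem_FW : ρ ∈ C.FW Ω l ↔ ρ ∈ C.runs ∧ ∃ i, ∀ j ≥ i, Ω.Closes l (ρ.suffix j) := by
  simp only [FW, Set.mem_ofPred_eq, mem_DFW, Play.suffix_suffix]
  refine and_congr_right fun h => exists_congr fun i => ?_
  rw [and_iff_right (suffix_mem_runs h i)]
  exact ⟨fun hi j hj => Nat.add_sub_cancel' hj ▸ hi (j - i),
    fun hi j => hi _ (Nat.le_add_right i j)⟩

lemma IsEC.exists_descent (hC : C.IsEC) {T : Set S} (hT : T.Nonempty) (hTC : T ⊆ C.states) :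
    ∃ (d : S → ℕ) (α : S → A), (∀ s ∈ C.states, α s ∈ C.act s) ∧
      ∀ s ∈ C.states, s ∉ T → ∃ t ∈ (M.next s (α s)).support, d t < d s := by
  obtain ⟨d, hd⟩ := exists_rank_of_reflTransGen (fun x y => ∃ a, C.Trans x a y) T
  have hact : ∀ s ∈ C.states, ∃ a ∈ C.act s,
      s ∉ T → ∃ t ∈ (M.next s a).support, d t < d s := by
    intro s hs
    by_cases hsT : s ∈ T
    · exact (C.act_nonempty s hs).imp fun a ha => ⟨ha, absurd hsT⟩
    · obtain ⟨y, hy⟩ := hT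
      obtain ⟨t, ⟨a, -, ha, ht⟩, hlt⟩ := hd s hsT ⟨y, hy, hC.2 s hs y (hTC hy)⟩
      exact ⟨a, ha, fun _ => ⟨t, ht, hlt⟩⟩
  obtain ⟨s, hs⟩ := hC.1
  have : Nonempty A := (C.act_nonempty s hs).to_type
  choose! α hα using hact
  exact ⟨d, α, fun s hs => (hα s hs).1, fun s hs => (hα s hs).2⟩

namespace Strategy

variable {C' : SubMDP M}

open Classical in
/-- The strategy which plays the action `α s` in the state `s` until `C'` is reached, and then
behaves like `σ'`. On a play, dropping the letters before the first visit to `C'` leaves a history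
of `C'` exactly when the play has reached `C'` and stayed in it since. -/
noncomputable def reachThen (hsub : C'.IsSubEC C) (σ' : C'.Strategy) (α : S → A)
    (hα : ∀ s ∈ C.states, α s ∈ C.act s) : C.Strategy where
  toFun h :=
    let tail : FinPlay S A := (h.1.dropWhile fun x => x.1 ∉ C'.states, h.2)
    if tail ∈ C'.hists then σ'.toFun tail else RatDist.pure (α h.2)
  supp h hh := by
    dsimp only
    split_ifs with htail
    · exact (σ'.supp _ htail).trans (hsub.2.2 _ (mem_states_of_mem_hists htail))
    · exact fun a ha => RatDist.mem_support_pure.1 ha ▸ hα _ (mem_states_of_mem_hists hh)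

variable {hsub : C'.IsSubEC C} {σ' : C'.Strategy} {α : S → A} {hα : ∀ s ∈ C.states, α s ∈ C.act s}

lemma reachThen_of_notMem {n : ℕ} (hn : (ρ n).1 ∉ C'.states) :
    (reachThen hsub σ' α hα).toFun (ρ.pre n) = RatDist.pure (α (ρ n).1) :=
  if_neg fun htail => hn (mem_states_of_mem_hists htail)

open Classical in
lemma reachThen_of_mem {m i : ℕ} (hlt : ∀ j < m, (ρ j).1 ∉ C'.states) (hm : (ρ m).1 ∈ C'.states)
    (hi : (ρ.suffix m).pre i ∈ C'.hists) :
    (reachThen hsub σ' α hα).toFun (ρ.pre (m + i)) = σ'.toFun ((ρ.suffix m).pre i) := by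
  have htail : (ρ.word (m + i)).dropWhile (fun x => x.1 ∉ C'.states) = (ρ.suffix m).word i := by
    rw [Play.word_add, List.dropWhile_append_of_pos]
    · rcases i with _ | i
      · rfl
      · rw [Play.word, List.ofFn_succ, List.dropWhile_cons_of_neg (by simpa [Play.suffix] using hm)]
    · simpa [Play.word, List.forall_mem_ofFn_iff, Fin.forall_iff] using hlt
  have htail' : ((ρ.word (m + i)).dropWhile (fun x => x.1 ∉ C'.states), (ρ (m + i)).1) =
      (ρ.suffix m).pre i := Prod.ext htail rfl
  change ite (((ρ.word (m + i)).dropWhile (fun x => x.1 ∉ C'.states), (ρ (m + i)).1) ∈ C'.hists)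
    (σ'.toFun ((ρ.word (m + i)).dropWhile (fun x => x.1 ∉ C'.states), (ρ (m + i)).1)) _ = _
  rw [htail', if_pos hi]

lemma reachThen_suffix_mem_runsFrom {s : S} (hρ : ρ ∈ (reachThen hsub σ' α hα).runsFrom s) {m : ℕ}
    (hlt : ∀ i < m, (ρ i).1 ∉ C'.states) (hm : (ρ m).1 ∈ C'.states) :
    ρ.suffix m ∈ σ'.runsFrom (ρ m).1 :=
  mem_runsFrom_of_forall hm rfl (fun n => (hρ.1 (m + n)).2.2) fun n hn =>
    reachThen_of_mem hlt hm hn ▸ hρ.2.2 (m + n)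

end Strategy

section Measure

variable [Finite S] [Finite A]
  [MeasurableSpace S] [DiscreteMeasurableSpace S] [MeasurableSpace A] [DiscreteMeasurableSpace A]

lemma IsGood.exists_strategy_prob_FW_eq_one (hC : C.IsEC) (hg : C.IsGood Ω l) :
    ∃ σ : C.Strategy, ∀ s ∈ C.states, σ.prob s (C.FW Ω l) = 1 := by
  obtain ⟨C', hsub, σ', hsafe⟩ := hg
  obtain ⟨d, α, hα, hdesc⟩ := hC.exists_descent hsub.1.1 hsub.2.1
  let σ := Strategy.reachThen hsub σ' α hα
  have hFW : ∀ s, ∀ ρ ∈ σ.runsFrom s, M.IsFair ρ → ρ ∈ C.FW Ω l := by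
    intro s ρ hρ hfair
    have hvisit : ∃ n, (ρ n).1 ∈ C'.states := by
      by_contra! hnot
      obtain ⟨n, hn⟩ := hfair.exists_forall_le d
      have hact : (ρ n).2 = α (ρ n).1 := by
        have := hρ.2.2 n
        rwa [Strategy.reachThen_of_notMem (hnot n), RatDist.mem_support_pure] at this
      obtain ⟨t, ht, hlt⟩ := hdesc _ (hρ.1 n).1 (hnot n)
      exact (hn t (hact ▸ ht)).not_gt hlt
    classical
    have hDFW := mem_DFW.1 <| hsafe _ (Nat.find_spec hvisit) <|
      Strategy.reachThen_suffix_mem_runsFrom hρ (fun _ => Nat.find_min hvisit)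
        (Nat.find_spec hvisit)
    exact mem_FW.2 ⟨hρ.1, Nat.find hvisit, fun j hj => by
      simpa only [Play.suffix_suffix, Nat.add_sub_cancel' hj] using hDFW.2 (j - Nat.find hvisit)⟩
  refine ⟨σ, fun s hs => ?_⟩
  have hae : ∀ᵐ ρ ∂σ.prob s, ρ ∈ C.FW Ω l := by
    filter_upwards [σ.ae_mem_runsFrom hs, σ.ae_isFair s] using hFW s
  exact (measure_congr (Filter.eventuallyEq_univ.2 hae)).trans measure_univ

end Measure

lemma exists_strategy_of_invariant (C : SubMDP M) {I : List (S × A) → Prop}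
    (hinit : ∀ s ∈ C.states, ∃ a ∈ C.act s, I [(s, a)])
    (hstep : ∀ u s a t, I (u ++ [(s, a)]) → C.Trans s a t →
      ∃ b ∈ C.act t, I (u ++ [(s, a), (t, b)])) :
    ∃ σ : C.Strategy, ∀ s, ∀ ρ ∈ σ.runsFrom s, ∀ n, I (ρ.word (n + 1)) := by
  have hact : ∀ h : FinPlay S A, ∃ a, (h.2 ∈ C.states → a ∈ C.act h.2) ∧
      ((∃ b ∈ C.act h.2, I (h.1 ++ [(h.2, b)])) → I (h.1 ++ [(h.2, a)])) := by
    intro h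
    by_cases hI : ∃ b ∈ C.act h.2, I (h.1 ++ [(h.2, b)])
    · exact hI.imp fun b hb => ⟨fun _ => hb.1, fun _ => hb.2⟩
    · by_cases hs : h.2 ∈ C.states
      · exact (C.act_nonempty _ hs).imp fun a ha => ⟨fun _ => ha, fun h' => absurd h' hI⟩
      · exact (M.deadlockFree h.2).imp fun a _ => ⟨fun h' => absurd h' hs, fun h' => absurd h' hI⟩
  choose f hfact hfI using hact
  let σ : C.Strategy :=
    { toFun := fun h => RatDist.pure (f h)
      supp := fun h hh a ha =>
        RatDist.mem_support_pure.1 ha ▸ hfact h (mem_states_of_mem_hists hh) }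
  refine ⟨σ, fun s ρ hρ n => ?_⟩
  have hchoice : ∀ n, ρ n = ((ρ n).1, f (ρ.pre n)) := fun n =>
    Prod.ext rfl (RatDist.mem_support_pure.1 (hρ.2.2 n))
  have hextend : ∀ n, (∃ b ∈ C.act (ρ n).1, I (ρ.word n ++ [((ρ n).1, b)])) →
      I (ρ.word (n + 1)) := fun n hn => by
    rw [Play.word_succ, hchoice n]
    exact hfI (ρ.pre n) hn
  induction n with
  | zero => exact hextend 0 (hinit _ (hρ.1 0).1)
  | succ n ih =>
    refine hextend (n + 1) ?_
    rw [Play.word_succ] at ih ⊢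
    simpa only [List.append_assoc, List.singleton_append] using hstep _ _ _ _ ih (hρ.1 n)

lemma mem_of_recurs (hρ : ρ ∈ C.runs) {s : S} {a : A} (h : ρ.Recurs [(s, a)]) :
    s ∈ C.states ∧ a ∈ C.act s := by
  obtain ⟨n, hn⟩ := (Play.recurs_singleton.1 h).exists
  have htrans := hρ n
  rw [hn] at htrans
  exact ⟨htrans.1, htrans.2.1⟩

/-- The limit of a fair run: the states and the actions which occur infinitely often in it. -/
def limit [Finite A] (hρ : ρ ∈ C.runs) (hfair : M.IsFair ρ) : SubMDP M where
  states := {s | ∃ a, ρ.Recurs [(s, a)]}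
  act s := {a | ρ.Recurs [(s, a)]}
  act_nonempty _ hs := hs
  act_subset _ _ _ ha := (mem_of_recurs hρ ha).elim fun hs ha => C.act_subset _ hs ha
  closed _ _ _ ha _ ht :=
    (hfair.exists_recurs (u := []) ha ht).imp fun _ hb => hb.of_suffix (List.suffix_cons _ _)

lemma limit_isSubEC [Finite S] [Finite A] (hρ : ρ ∈ C.runs) (hfair : M.IsFair ρ) :
    (limit hρ hfair).IsSubEC C := by
  obtain ⟨N, hN⟩ := Filter.eventually_atTop.1 ρ.eventually_recurs
  have htrans : ∀ n ≥ N, (limit hρ hfair).Trans (ρ n).1 (ρ n).2 (ρ (n + 1)).1 := fun n hn =>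
    ⟨⟨_, hN n hn⟩, hN n hn, (hρ n).2.2⟩
  refine ⟨⟨⟨_, _, hN N le_rfl⟩, ?_⟩, fun s ⟨a, ha⟩ => (mem_of_recurs hρ ha).1,
    fun s _ a ha => (mem_of_recurs hρ ha).2⟩
  rintro s ⟨a, ha⟩ t ⟨b, hb⟩
  obtain ⟨n, hn, hs⟩ := Filter.frequently_atTop.1 (Play.recurs_singleton.1 ha) N
  obtain ⟨m, hm, ht⟩ := Filter.frequently_atTop.1 (Play.recurs_singleton.1 hb) n
  have hpath : ∀ m ≥ n, Relation.ReflTransGen (fun x y => ∃ a, (limit hρ hfair).Trans x a y)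
      (ρ n).1 (ρ m).1 := fun m hm => by
    induction m, hm using Nat.le_induction with
    | base => exact .refl
    | succ m hm ih => exact ih.tail ⟨_, htrans m (hn.trans hm)⟩
  simpa only [hs, ht] using hpath m hm

lemma exists_strategy_limit_recurs [Finite A] (hρ : ρ ∈ C.runs) (hfair : M.IsFair ρ) (n : ℕ) :
    ∃ σ : (limit hρ hfair).Strategy, ∀ s, ∀ ρ' ∈ σ.runsFrom s, ∀ j,
      ρ.Recurs ((ρ'.suffix j).word (n + 1)) := by
  obtain ⟨σ, hσ⟩ := (limit hρ hfair).exists_strategy_of_invariant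
    (I := fun u => ρ.Recurs (u.rtake (n + 1)))
    (fun s ⟨a, ha⟩ => ⟨a, ha, ha.of_suffix (List.drop_suffix _ _)⟩) <| by
      intro u s a t hu htrans
      rw [List.rtake_concat_succ] at hu
      obtain ⟨b, hb⟩ := hfair.exists_recurs hu htrans.2.2
      refine ⟨b, hb.of_suffix ⟨u.rtake n ++ [(s, a)], by simp⟩, hb.of_suffix ?_⟩
      rw [List.append_cons u, List.append_cons (u.rtake n), List.rtake_concat_succ,
        List.suffix_append_self_iff, ← List.rtake_concat_succ]
      exact List.drop_suffix_drop_left _ (by omega)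
  refine ⟨σ, fun s ρ' hρ' j => ?_⟩
  have hrecurs := hσ s ρ' hρ' (j + n)
  rwa [add_assoc, Play.word_add, List.rtake, List.length_append, Play.length_word,
    Play.length_word, Nat.add_sub_cancel, List.drop_left' (Play.length_word _ _)] at hrecurs

lemma limit_isSafe [Finite A] (hρ : ρ ∈ C.FW Ω l) (hfair : M.IsFair ρ) :
    (limit hρ.1 hfair).IsSafe Ω l := by
  obtain ⟨i, hi⟩ := (mem_FW.1 hρ).2
  obtain ⟨σ, hσ⟩ := exists_strategy_limit_recurs hρ.1 hfair l
  refine ⟨σ, fun s _ ρ' hρ' => mem_DFW.2 ⟨hρ'.1, fun j => ?_⟩⟩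
  obtain ⟨k, hk, heq⟩ := Filter.frequently_atTop.1 (hσ s ρ' hρ' j).frequently_suffix_eq i
  exact (hi k hk).congr fun m hm => heq m (hm.trans l.lt_succ_self)

lemma isGood_of_mem_FW [Finite S] [Finite A] (hρ : ρ ∈ C.FW Ω l) (hfair : M.IsFair ρ) :
    C.IsGood Ω l :=
  ⟨_, limit_isSubEC hρ.1 hfair, limit_isSafe hρ hfair⟩

variable [Finite S] [Finite A]
  [MeasurableSpace S] [DiscreteMeasurableSpace S] [MeasurableSpace A] [DiscreteMeasurableSpace A]

lemma prob_FW_eq_zero (hg : ¬ C.IsGood Ω l) (σ : C.Strategy) (s : S) :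
    σ.prob s (C.FW Ω l) = 0 :=
  measure_eq_zero_iff_ae_notMem.2 <| (σ.ae_isFair s).mono fun _ hfair hρ =>
    hg (isGood_of_mem_FW hρ hfair)

lemma prob_BW_eq_zero (hg : ¬ C.IsBWGood Ω) (σ : C.Strategy) (s : S) : σ.prob s (C.BW Ω) = 0 :=
  measure_eq_zero_iff_ae_notMem.2 <| (σ.ae_isFair s).mono fun _ hfair ⟨_, l, hl, hρ⟩ =>
    let ⟨C', hsub, hsafe⟩ := isGood_of_mem_FW hρ hfair
    hg ⟨C', hsub, l, hl, hsafe⟩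

lemma IsBWGood.exists_strategy_prob_BW_eq_one (hC : C.IsEC) (hg : C.IsBWGood Ω) :
    ∃ σ : C.Strategy, ∀ s ∈ C.states, σ.prob s (C.BW Ω) = 1 := by
  obtain ⟨C', hsub, l, hl, hsafe⟩ := hg
  obtain ⟨σ, hσ⟩ := IsGood.exists_strategy_prob_FW_eq_one hC ⟨C', hsub, hsafe⟩
  have hFW : C.FW Ω l ⊆ C.BW Ω := fun ρ hρ => ⟨hρ.1, l, hl, hρ⟩
  exact ⟨σ, fun s hs => prob_le_one.antisymm ((hσ s hs).ge.trans (measure_mono hFW))⟩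

end MDP.SubMDP

theorem lemma5p4 {S A : Type*} [Finite S] [Finite A]
    [MeasurableSpace S] [DiscreteMeasurableSpace S]
    [MeasurableSpace A] [DiscreteMeasurableSpace A]
    (M : MDP S A) (Ω : WindowKind S A) (C : MDP.SubMDP M) (hC : C.IsEC) :
    (∀ l : ℕ, 0 < l →
      (C.IsGood Ω l ∧ ∃ σ : C.Strategy, ∀ s ∈ C.states, σ.prob s (C.FW Ω l) = 1) ∨
      (¬ C.IsGood Ω l ∧ ∀ s ∈ C.states, ∀ σ : C.Strategy, σ.prob s (C.FW Ω l) = 0)) ∧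
    ((C.IsBWGood Ω ∧ ∃ σ : C.Strategy, ∀ s ∈ C.states, σ.prob s (C.BW Ω) = 1) ∨
      (¬ C.IsBWGood Ω ∧ ∀ s ∈ C.states, ∀ σ : C.Strategy, σ.prob s (C.BW Ω) = 0)) := by
  refine ⟨fun l _ => ?_, ?_⟩
  · by_cases hg : C.IsGood Ω l
    · exact .inl ⟨hg, hg.exists_strategy_prob_FW_eq_one hC⟩
    · exact .inr ⟨hg, fun s _ σ => MDP.SubMDP.prob_FW_eq_zero hg σ s⟩
  · by_cases hg : C.IsBWGood Ω
    · exact .inl ⟨hg, hg.exists_strategy_prob_BW_eq_one hC⟩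
    · exact .inr ⟨hg, fun s _ σ => MDP.SubMDP.prob_BW_eq_zero hg σ s⟩
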